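/- Let $\ell\ge 1$ be an integer. The Nörlund numbers $B_n^{(\ell)}$ are defined by $\sum_{n\ge 0}B_n^{(\ell)}\frac{t^n}{n!}=\left(\frac{t}{e^t-1}\right)^{\ell}$, the modified Nörlund numbers by $$B_n^{(\ell)*}=\sum_{r=0}^{n}\binom{n+r}{2r}\frac{B_r^{(\ell)}}{n+r}\qquad(n\ge 1),$$ and the densities $\rho_\ell$ on $\mathbb R$ by $\rho_1(u)=\frac{\pi}{2}\,\mathrm{sech}^2(\pi u)$ and $\rho_{\ell}(x)=\int_{-\infty}^{\infty}\rho_{\ell-1}(u)\rho_1(x-u)\,du$ for $\ell\ge 2$. Then the generating function $F_{B^*}(z;\ell)=\sum_{n\ge 1}B_n^{(\ell)*}z^n$, viewed as a formal power series, is given by $$F_{B^*}(z;\ell)=-\tfrac12\log z-\tfrac12\log\left|x-\tfrac{\ell}{2}\right|-\tfrac12\int_0^\infty\log(1+bu^2)\,\rho_\ell(u)\,du,\qquad x=z+\tfrac1z+\ell-2,\quad b=\left(x-\tfrac{\ell}{2}\right)^{-2},$$ in both of the following senses. (a) For every real $z>0$ one has $x\ne \ell/2$ and the integral converges absolutely,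 and the right-hand side, denoted $R_\ell(z)$, has the series as its asymptotic expansion to all orders: for every $N\ge 0$, $R_\ell(z)=\sum_{n=1}^{N}B_n^{(\ell)*}z^n+O(z^{N+1})$ as $z\to 0^+$. (b) In $\mathbb R[[z]]$, with $q=z\left(x-\frac{\ell}{2}\right)=1+\left(\frac{\ell}{2}-2\right)z+z^2$ and $b=z^2/q^2$, $$\sum_{n\ge 1}B_n^{(\ell)*}z^n=-\tfrac12\log q-\tfrac12\sum_{n\ge 0}\left(\int_0^\infty [z^n]\log(1+bu^2)\,\rho_\ell(u)\,du\right)z^n,$$ where $\log(1+f)=\sum_{k\ge 1}(-1)^{k-1}f^k/k$ for a power series $f$ without constant term, $[z^n]$ denotes the coefficient of $z^n$, and all the integrals converge absolutely. -/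

import Mathlib

open scoped Topology PowerSeries LaurentSeries
open Asymptotics

noncomputable section

namespace Norlund

/-- The formal power series `t / (e^t - 1)`, i.e. the inverse of `(e^t - 1) / t = ∑ t^n / (n+1)!`. -/
def todd : ℝ⟦X⟧ := (PowerSeries.mk fun n => (1 : ℝ) / (n + 1).factorial)⁻¹

theorem todd_mul_exp_sub_one : todd * (PowerSeries.exp ℝ - 1) = PowerSeries.X := by
  have h : PowerSeries.exp ℝ - 1
      = PowerSeries.X * PowerSeries.mk fun n => (1 : ℝ) / (n + 1).factorial := by
    ext n
    rcases n with _ | n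
    · simp
    · simp [PowerSeries.coeff_succ_X_mul, PowerSeries.coeff_exp, PowerSeries.coeff_one]
  have hne : PowerSeries.constantCoeff
      (PowerSeries.mk fun n => (1 : ℝ) / (n + 1).factorial) ≠ 0 := by
    simp [← PowerSeries.coeff_zero_eq_constantCoeff_apply]
  rw [h, mul_left_comm, todd, PowerSeries.inv_mul_cancel _ hne, mul_one]

/-- The (value at `α = ℓ` of the) `n`-th Nörlund polynomial `B_n^{(ℓ)}`, defined by
`∑ B_n^{(ℓ)} t^n / n! = (t / (e^t - 1))^ℓ`. -/
def norlund (ℓ n : ℕ) : ℝ := n.factorial * PowerSeries.coeff n (todd ^ ℓ)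

/-- The modified Nörlund numbers
`B_n^{(ℓ)*} = ∑_{r=0}^n binom(n+r, 2r) B_r^{(ℓ)} / (n+r)`, for `n ≥ 1`. -/
def modNorlund (ℓ n : ℕ) : ℝ :=
  ∑ r ∈ Finset.range (n + 1), ((n + r).choose (2 * r) : ℝ) * (norlund ℓ r / ((n : ℝ) + r))

/-- The generating function `∑_{n ≥ 1} B_n^{(ℓ)*} z^n`, as a formal power series in `z`. -/
def genFun (ℓ : ℕ) : ℝ⟦X⟧ :=
  PowerSeries.mk fun n => if n = 0 then 0 else modNorlund ℓ n

/-- The densities: `ρ_1(u) = (π/2) sech²(π u)` and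
`ρ_{ℓ}(x) = ∫ ρ_{ℓ-1}(u) ρ_1(x - u) du` for `ℓ ≥ 2`. The value at `ℓ = 0` is a placeholder. -/
def rho : ℕ → ℝ → ℝ
  | 0 => fun _ => 0
  | 1 => fun u => Real.pi / 2 * (1 / Real.cosh (Real.pi * u)) ^ 2
  | ℓ + 2 => fun x => ∫ u : ℝ, rho (ℓ + 1) u * rho 1 (x - u)

/-- `x = z + 1/z + ℓ - 2`. -/
def xArg (ℓ : ℕ) (z : ℝ) : ℝ := z + 1 / z + ℓ - 2

/-- `b = (x - ℓ/2)^{-2}` with `x = z + 1/z + ℓ - 2`. -/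
def bArg (ℓ : ℕ) (z : ℝ) : ℝ := ((xArg ℓ z - (ℓ : ℝ) / 2) ^ 2)⁻¹

/-- `-½ log z - ½ log |x - ℓ/2| - ½ ∫_0^∞ log(1 + b u²) ρ_ℓ(u) du`. -/
def closedForm (ℓ : ℕ) (z : ℝ) : ℝ :=
  -(1 / 2) * Real.log z - 1 / 2 * Real.log |xArg ℓ z - (ℓ : ℝ) / 2|
    - 1 / 2 * ∫ u in Set.Ioi (0 : ℝ), Real.log (1 + bArg ℓ z * u ^ 2) * rho ℓ u

/-- The polynomial `q = z (x - ℓ/2) = 1 + (ℓ/2 - 2) z + z²`, with `x = z + 1/z + ℓ - 2`.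
Since `log z + log (x - ℓ/2) = log q` and `q` has constant term `1`, the formal series
`PowerSeries.logOf q` is the formal reading of `log z + log |x - ℓ/2|`. -/
def qSeries (ℓ : ℕ) : ℝ⟦X⟧ :=
  1 + PowerSeries.C ((ℓ : ℝ) / 2 - 2) * PowerSeries.X + PowerSeries.X ^ 2

/-- `x = z + 1/z + ℓ - 2` as a formal Laurent series in `z`. -/
def xSeries (ℓ : ℕ) : ℝ⸨X⸩ :=
  ((PowerSeries.X : ℝ⟦X⟧) : ℝ⸨X⸩) + ((PowerSeries.X : ℝ⟦X⟧) : ℝ⸨X⸩)⁻¹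
    + ((PowerSeries.C ((ℓ : ℝ) - 2) : ℝ⟦X⟧) : ℝ⸨X⸩)

/-- `b = (x - ℓ/2)^{-2} = z² / q²` as a formal power series in `z`. -/
def bSeries (ℓ : ℕ) : ℝ⟦X⟧ := PowerSeries.X ^ 2 * (qSeries ℓ ^ 2)⁻¹

theorem coe_X_ne_zero : ((PowerSeries.X : ℝ⟦X⟧) : ℝ⸨X⸩) ≠ 0 := by
  intro h
  exact PowerSeries.X_ne_zero
    (HahnSeries.ofPowerSeries_injective (Γ := ℤ) (R := ℝ) (h.trans (map_zero _).symm))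

theorem qSeries_eq (ℓ : ℕ) :
    (qSeries ℓ : ℝ⸨X⸩) = ((PowerSeries.X : ℝ⟦X⟧) : ℝ⸨X⸩)
      * (xSeries ℓ - ((PowerSeries.C ((ℓ : ℝ) / 2) : ℝ⟦X⟧) : ℝ⸨X⸩)) := by
  have hX := coe_X_ne_zero
  have h : (PowerSeries.C ((ℓ : ℝ) / 2 - 2) : ℝ⟦X⟧)
      = PowerSeries.C ((ℓ : ℝ) - 2) - PowerSeries.C ((ℓ : ℝ) / 2) := by
    rw [← map_sub]; congr 1; ring
  rw [qSeries, xSeries, h]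
  push_cast
  field_simp
  ring

theorem bSeries_eq (ℓ : ℕ) :
    (bSeries ℓ : ℝ⸨X⸩) = ((xSeries ℓ - ((PowerSeries.C ((ℓ : ℝ) / 2) : ℝ⟦X⟧) : ℝ⸨X⸩)) ^ 2)⁻¹ := by
  have hX := coe_X_ne_zero
  have hq0 : PowerSeries.constantCoeff (qSeries ℓ ^ 2) ≠ 0 := by simp [qSeries]
  have hinv : ((qSeries ℓ : ℝ⸨X⸩)) ^ 2 * (((qSeries ℓ ^ 2)⁻¹ : ℝ⟦X⟧) : ℝ⸨X⸩) = 1 := by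
    rw [← PowerSeries.coe_pow, ← PowerSeries.coe_mul, PowerSeries.mul_inv_cancel _ hq0,
      PowerSeries.coe_one]
  refine eq_inv_of_mul_eq_one_left ?_
  rw [bSeries, PowerSeries.coe_mul, PowerSeries.coe_pow]
  rw [qSeries_eq] at hinv
  linear_combination hinv

/-- The formal reading of `∫_0^∞ log(1 + b u²) ρ_ℓ(u) du`: for each `u`, expand `log(1 + b u²)` as a
formal power series in `z`, then integrate against `ρ_ℓ` coefficient by coefficient. -/
def logMomentSeries (ℓ : ℕ) : ℝ⟦X⟧ :=
  PowerSeries.mk fun n => ∫ u in Set.Ioi (0 : ℝ),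
    PowerSeries.coeff n (PowerSeries.logOf (1 + bSeries ℓ * PowerSeries.C (u ^ 2))) * rho ℓ u

end Norlund

end

/-! ### Contour shift for powers against the squared hyperbolic secant. -/

namespace Norlund

noncomputable section

open MeasureTheory Filter Complex

/-! The Nörlund numbers are moments: `B_n^{(ℓ)} = ∫ (iu - ℓ/2)^n ρ_ℓ(u) du`
(`integral_momentIntegrand`). For `ℓ = 1`, shifting the contour of `s^n / sin²(πs)` from `Re s =
1/2` to `Re s = -1/2` gives the Bernoulli recurrence (`integral_shift_pow_div_cosh_sq`). Convolution
with `ρ_1` becomes, by the binomial theorem, multiplication by `t / (e^t - 1)`, which gives all `ℓ`.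

Hence `B_n^{(ℓ)*}` is the integral against `ρ_ℓ` of `modPoly n` at `w = iu - ℓ/2`. These are
Chebyshev polynomials divided by `n`, with generating function `-½ log(1 - (2 + w) z + z²)`
(`mk_modPoly_eq_logOf`). At this `w` the quadratic is `q - iuz`, so averaging over `u` and `-u`
produces `(q - iuz)(q + iuz) = q²(1 + b u²)`. Taking logarithms and integrating coefficientwise is
the formal identity `genFun_eq`.

For the asymptotic statement, the Taylor remainder of `log(1 + y)` is at most `y^(N+1)` for every `y
≥ 0` (`abs_log_one_add_sub_sum_le`). As all moments of `ρ_ℓ` are finite, the integral has an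
expansion in powers of `b`, and `HasExpansion` carries this to the same formal series in `z`. -/

theorem exists_one_add_abs_pow_div_cosh_sq_le (n : ℕ) :
    ∃ C : ℝ, 0 ≤ C ∧ ∀ u : ℝ,
      (1 + |u|) ^ n / Real.cosh (Real.pi * u) ^ 2 ≤ C * (1 + u ^ 2)⁻¹ := by
  -- From `(1 + |u|)^(n+2) ≤ (n+2)! e^(1+|u|)` and `e^|u| ≤ 2 cosh(πu)`; the two extra powers absorb
  -- `1 + u²`.
  refine ⟨2 * Real.exp 1 * (n + 2).factorial, by positivity, fun u => ?_⟩
  have h1 : (1 + |u|) ^ (n + 2) / (n + 2).factorial ≤ Real.exp (1 + |u|) :=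
    Real.pow_div_factorial_le_exp _ (by positivity) _
  have h2 : Real.exp |u| ≤ 2 * Real.cosh (Real.pi * u) := by
    have hpi : |u| ≤ |Real.pi * u| := by
      rw [abs_mul, abs_of_pos Real.pi_pos]
      nlinarith [abs_nonneg u, Real.pi_gt_three]
    rw [← Real.cosh_abs (Real.pi * u), Real.cosh_eq]
    have := Real.exp_le_exp.2 hpi
    have := Real.exp_pos (-|Real.pi * u|)
    linarith
  have h3 : 1 ≤ Real.cosh (Real.pi * u) := Real.one_le_cosh _
  have h4 : 1 + u ^ 2 ≤ (1 + |u|) ^ 2 := by nlinarith [abs_nonneg u, sq_abs u]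
  rw [← div_eq_mul_inv, div_le_div_iff₀ (by positivity) (by positivity)]
  rw [div_le_iff₀ (by positivity), Real.exp_add] at h1
  have hf : (0 : ℝ) < (n + 2).factorial := by positivity
  calc (1 + |u|) ^ n * (1 + u ^ 2) ≤ (1 + |u|) ^ n * (1 + |u|) ^ 2 := by gcongr
    _ = (1 + |u|) ^ (n + 2) := by ring
    _ ≤ Real.exp 1 * Real.exp |u| * (n + 2).factorial := h1
    _ ≤ Real.exp 1 * (2 * Real.cosh (Real.pi * u) ^ 2) * (n + 2).factorial := by
        gcongr
        nlinarith
    _ = _ := by ring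

theorem norm_ofReal_mul_I_add_pow_le (c u : ℝ) (hc : |c| ≤ 1) (n : ℕ) :
    ‖((u : ℂ) * I + c) ^ n‖ ≤ (1 + |u|) ^ n := by
  rw [norm_pow]
  gcongr
  refine (norm_add_le _ _).trans ?_
  simp
  linarith

theorem cosh_pi_mul_ne_zero (u : ℝ) : Complex.cosh (Real.pi * u) ≠ 0 := by
  rw [← ofReal_mul, ← ofReal_cosh]
  exact_mod_cast (Real.cosh_pos _).ne'

theorem integrable_pow_div_cosh_sq (c : ℝ) (hc : |c| ≤ 1) (n : ℕ) :
    Integrable fun u : ℝ => ((u : ℂ) * I + c) ^ n / Complex.cosh (Real.pi * u) ^ 2 := by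
  obtain ⟨C, -, hC⟩ := exists_one_add_abs_pow_div_cosh_sq_le n
  refine (integrable_inv_one_add_sq.const_mul C).mono' ?_ (ae_of_all _ fun u => ?_)
  · refine Continuous.aestronglyMeasurable ?_
    refine Continuous.div (by fun_prop) (by fun_prop) fun u => ?_
    exact pow_ne_zero _ (cosh_pi_mul_ne_zero u)
  · refine le_trans ?_ (hC u)
    rw [norm_div, norm_pow _ 2, ← ofReal_mul, ← ofReal_cosh, norm_real, Real.norm_eq_abs, sq_abs]
    gcongr
    exact norm_ofReal_mul_I_add_pow_le c u hc n

/-- `s ^ m / (sin (π s) / s) ^ 2`, with the singularity at the origin removed. -/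
def cscSqPow (m : ℕ) (s : ℂ) : ℂ :=
  s ^ m / (dslope (fun s : ℂ => Complex.sin (Real.pi * s)) 0 s) ^ 2

theorem cscSqPow_of_ne (m : ℕ) {s : ℂ} (hs : s ≠ 0) :
    cscSqPow m s = s ^ (m + 2) / Complex.sin (Real.pi * s) ^ 2 := by
  rw [cscSqPow, dslope_of_ne _ hs, slope_def_field]
  simp only [mul_zero, Complex.sin_zero, sub_zero, div_pow]
  rw [pow_add]
  field_simp

/-- The zeros of `sin(πs)` are the integers; the strip contains only `0`, a simple zero with
derivative `π`. -/
theorem dslope_sin_pi_ne_zero {s : ℂ} (hs : |s.re| ≤ 1 / 2) :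
    dslope (fun s : ℂ => Complex.sin (Real.pi * s)) 0 s ≠ 0 := by
  rcases eq_or_ne s 0 with rfl | h0
  · have : HasDerivAt (fun s : ℂ => Complex.sin (Real.pi * s))
        (Complex.cos (Real.pi * 0) * (Real.pi * 1)) 0 :=
      ((hasDerivAt_id (0 : ℂ)).const_mul (Real.pi : ℂ)).csin
    rw [dslope_same, this.deriv]
    simp [Real.pi_ne_zero]
  · rw [dslope_of_ne _ h0, slope_def_field]
    simp only [mul_zero, Complex.sin_zero, sub_zero]
    refine div_ne_zero (fun h => h0 ?_) h0
    obtain ⟨k, hk⟩ := Complex.sin_eq_zero_iff.1 h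
    have hs' : s = k := by
      have hpi : (Real.pi : ℂ) ≠ 0 := by exact_mod_cast Real.pi_ne_zero
      apply mul_left_cancel₀ hpi
      rw [hk]; ring
    have hk0 : k = 0 := by
      rw [hs'] at hs
      simp only [intCast_re] at hs
      have : |(k : ℝ)| < 1 := by linarith
      have : |k| < 1 := by exact_mod_cast this
      exact Int.abs_lt_one_iff.1 this
    simp [hs', hk0]

theorem differentiableAt_cscSqPow (m : ℕ) {s : ℂ} (hs : |s.re| ≤ 1 / 2) :
    DifferentiableAt ℂ (cscSqPow m) s := by
  have hd : Differentiable ℂ (dslope (fun s : ℂ => Complex.sin (Real.pi * s)) 0) := by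
    rw [← differentiableOn_univ]
    refine (Complex.differentiableOn_dslope (by simp)).2 ?_
    rw [differentiableOn_univ]
    fun_prop
  exact (differentiableAt_id.pow m).div ((hd s).pow 2) (pow_ne_zero _ (dslope_sin_pi_ne_zero hs))

theorem cscSqPow_right (m : ℕ) (y : ℝ) :
    cscSqPow m (((1 / 2 : ℝ) : ℂ) + y * I)
      = ((y : ℂ) * I + (1 / 2 : ℝ)) ^ (m + 2) / Complex.cosh (Real.pi * y) ^ 2 := by
  rw [cscSqPow_of_ne]
  · congr 2
    · ring
    · have : (Real.pi : ℂ) * (((1 / 2 : ℝ) : ℂ) + y * I) = Real.pi / 2 + Real.pi * y * I := by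
        push_cast; ring
      rw [this, add_comm, Complex.sin_add_pi_div_two, Complex.cos_mul_I]
  · intro h
    have := congrArg Complex.re h
    norm_num at this

theorem cscSqPow_left (m : ℕ) (y : ℝ) :
    cscSqPow m (((-1 / 2 : ℝ) : ℂ) + y * I)
      = ((y : ℂ) * I + (-1 / 2 : ℝ)) ^ (m + 2) / Complex.cosh (Real.pi * y) ^ 2 := by
  rw [cscSqPow_of_ne]
  · congr 1
    · ring
    · have : (Real.pi : ℂ) * (((-1 / 2 : ℝ) : ℂ) + y * I) = Real.pi * y * I - Real.pi / 2 := by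
        push_cast; ring
      rw [this, Complex.sin_sub_pi_div_two, Complex.cos_mul_I, neg_sq]
  · intro h
    have := congrArg Complex.re h
    norm_num at this

theorem sinh_sq_le_norm_sin_sq (x y : ℝ) :
    Real.sinh y ^ 2 ≤ ‖Complex.sin (x + y * I)‖ ^ 2 := by
  rw [Complex.sin_add_mul_I, ← ofReal_sin, ← ofReal_cos, ← ofReal_sinh, ← ofReal_cosh,
    ← ofReal_mul, ← ofReal_mul, Complex.sq_norm, Complex.normSq_add_mul_I]
  have h1 := Real.sin_sq_add_cos_sq x
  have h2 := Real.cosh_sq y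
  nlinarith [sq_nonneg (Real.sin x), sq_nonneg (Real.sinh y), sq_nonneg (Real.cos x)]

/-- `|sin(π(x + iT))|` is at least `|sinh(πT)|`, and `cosh² ≤ 2 sinh²` once `|T| ≥ 1`. Thus the
horizontal sides of the contour obey the same majorant as the vertical ones. -/
theorem norm_cscSqPow_le (m : ℕ) {x T : ℝ} (hx : |x| ≤ 1) (hT : 1 ≤ |T|) :
    ‖cscSqPow m (x + T * I)‖ ≤ 2 * ((1 + |T|) ^ (m + 2) / Real.cosh (Real.pi * T) ^ 2) := by
  have hs1 : 1 ≤ Real.sinh (Real.pi * T) ^ 2 := by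
    rw [← sq_abs, Real.abs_sinh]
    have h1 : 1 ≤ |Real.pi * T| := by
      rw [abs_mul, abs_of_pos Real.pi_pos]
      nlinarith [Real.pi_gt_three]
    have := (Real.self_le_sinh_iff.2 (abs_nonneg (Real.pi * T)))
    nlinarith
  have hc : Real.cosh (Real.pi * T) ^ 2 ≤ 2 * Real.sinh (Real.pi * T) ^ 2 := by
    rw [Real.cosh_sq]; linarith
  have hcp : 0 < Real.cosh (Real.pi * T) := Real.cosh_pos _
  rw [cscSqPow_of_ne]
  · have harg : (Real.pi : ℂ) * (x + T * I) = ((Real.pi * x : ℝ) : ℂ) + ((Real.pi * T : ℝ) : ℂ) * I := by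
      push_cast; ring
    have hsin := sinh_sq_le_norm_sin_sq (Real.pi * x) (Real.pi * T)
    rw [norm_div, harg, norm_pow (Complex.sin _), ← mul_div_assoc,
      div_le_div_iff₀ (by linarith) (by positivity)]
    have hn := norm_ofReal_mul_I_add_pow_le x T hx (m + 2)
    rw [add_comm (x : ℂ)]
    calc _ ≤ (1 + |T|) ^ (m + 2) * (2 * ‖Complex.sin (((Real.pi * x : ℝ) : ℂ)
              + ((Real.pi * T : ℝ) : ℂ) * I)‖ ^ 2) := by
            gcongr
            linarith
      _ = _ := by ring
  · intro h
    have := congrArg Complex.im h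
    simp at this
    rw [this] at hT
    norm_num at hT

theorem tendsto_integral_cscSqPow (m : ℕ) (T : ℝ → ℝ) (hT : Tendsto (fun t => |T t|) atTop atTop) :
    Tendsto (fun t : ℝ => ∫ x : ℝ in (-1 / 2 : ℝ)..(1 / 2), cscSqPow m (x + T t * I))
      atTop (𝓝 0) := by
  obtain ⟨C, -, hC⟩ := exists_one_add_abs_pow_div_cosh_sq_le (m + 2)
  have hlim : Tendsto (fun t => 2 * (C * (1 + |T t| ^ 2)⁻¹)) atTop (𝓝 0) := by
    have h1 : Tendsto (fun s : ℝ => 1 + s ^ 2) atTop atTop :=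
      tendsto_atTop_add_const_left _ _ (tendsto_pow_atTop two_ne_zero)
    have h2 := ((h1.comp hT).inv_tendsto_atTop.const_mul C).const_mul 2
    simpa using h2
  refine squeeze_zero_norm' ?_ hlim
  filter_upwards [hT.eventually_ge_atTop 1] with t ht
  have := intervalIntegral.norm_integral_le_of_norm_le_const (a := (-1 / 2 : ℝ)) (b := 1 / 2)
    (f := fun x : ℝ => cscSqPow m (x + T t * I)) (C := 2 * (C * (1 + |T t| ^ 2)⁻¹)) ?_
  · refine this.trans (le_of_eq ?_)
    norm_num
  · intro x hx
    rw [Set.uIoc_of_le (by norm_num)] at hx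
    refine (norm_cscSqPow_le m (abs_le.2 ⟨by linarith [hx.1], by linarith [hx.2]⟩) ht).trans ?_
    have := hC (T t)
    rw [← sq_abs] at this
    gcongr
    simpa using this

/-- Cauchy's theorem on the rectangle with corners `±1/2 ± iT`, as `T → ∞`. The exponent `m + 2`
cancels the double pole of `1 / sin²(πs)` at the origin, so no residue appears. -/
theorem integral_shift_pow_div_cosh_sq (m : ℕ) :
    ∫ u : ℝ, ((u : ℂ) * I + (1 / 2 : ℝ)) ^ (m + 2) / Complex.cosh (Real.pi * u) ^ 2
      = ∫ u : ℝ, ((u : ℂ) * I + (-1 / 2 : ℝ)) ^ (m + 2) / Complex.cosh (Real.pi * u) ^ 2 := by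
  have hr := intervalIntegral_tendsto_integral
    (integrable_pow_div_cosh_sq (1 / 2) (by norm_num [abs_le]) (m + 2)) tendsto_neg_atTop_atBot tendsto_id
  have hl := intervalIntegral_tendsto_integral
    (integrable_pow_div_cosh_sq (-1 / 2) (by norm_num [abs_le]) (m + 2)) tendsto_neg_atTop_atBot tendsto_id
  have hb := tendsto_integral_cscSqPow m (fun t => -t) (by simpa using tendsto_abs_atTop_atTop)
  have ht := tendsto_integral_cscSqPow m (fun t => t) tendsto_abs_atTop_atTop
  have key := (((hb.sub ht).add (hr.const_smul I)).sub (hl.const_smul I))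
  have hzero : ∀ T : ℝ, (∫ x : ℝ in (-1 / 2 : ℝ)..(1 / 2), cscSqPow m (x + ((-T : ℝ) : ℂ) * I))
      - (∫ x : ℝ in (-1 / 2 : ℝ)..(1 / 2), cscSqPow m (x + (T : ℂ) * I))
      + I • (∫ u : ℝ in (-T)..T, ((u : ℂ) * I + (1 / 2 : ℝ)) ^ (m + 2)
          / Complex.cosh (Real.pi * u) ^ 2)
      - I • (∫ u : ℝ in (-T)..T, ((u : ℂ) * I + (-1 / 2 : ℝ)) ^ (m + 2)
          / Complex.cosh (Real.pi * u) ^ 2) = 0 := by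
    intro T
    have h := Complex.integral_boundary_rect_eq_zero_of_differentiableOn (cscSqPow m)
      ⟨-1 / 2, -T⟩ ⟨1 / 2, T⟩ ?_
    · simp only [cscSqPow_right, cscSqPow_left] at h
      exact h
    · intro s hs
      have hre := hs.1
      simp only [Set.mem_preimage] at hre
      rw [Set.uIcc_of_le (by norm_num)] at hre
      exact (differentiableAt_cscSqPow m
        (abs_le.2 ⟨by linarith [hre.1], hre.2⟩)).differentiableWithinAt
  have key0 := tendsto_nhds_unique key (tendsto_const_nhds.congr fun T => (hzero T).symm)
  simp only [sub_zero, zero_add, ← smul_sub] at key0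
  exact sub_eq_zero.1 ((smul_eq_zero_iff_right I_ne_zero).1 key0)

end

end Norlund

/-! ### Nörlund numbers as moments of the densities. -/

namespace Norlund

noncomputable section

open MeasureTheory Filter Complex

theorem rho_neg {ℓ : ℕ} (hℓ : 1 ≤ ℓ) (x : ℝ) : rho ℓ (-x) = rho ℓ x := by
  have h1 : ∀ x, rho 1 (-x) = rho 1 x := fun x => by simp [rho]
  induction ℓ, hℓ using Nat.le_induction generalizing x with
  | base => exact h1 x
  | succ ℓ hℓ ih =>
    obtain ⟨k, rfl⟩ : ∃ k, ℓ = k + 1 := ⟨ℓ - 1, by lia⟩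
    rw [rho]
    beta_reduce
    rw [← integral_neg_eq_self]
    refine integral_congr_ae (ae_of_all _ fun u => ?_)
    simp only
    rw [ih, ← h1 (x - u)]
    congr 2
    ring

/-- The function `(iu - ℓ/2)^n ρ_ℓ(u)`, whose integral is `B_n^{(ℓ)}`. -/
def momentIntegrand (ℓ n : ℕ) (u : ℝ) : ℂ :=
  ((u : ℂ) * I - ℓ / 2) ^ n * (rho ℓ u : ℂ)

theorem rho_one_eq (u : ℝ) :
    (rho 1 u : ℂ) = Real.pi / 2 * (1 / Complex.cosh (Real.pi * u) ^ 2) := by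
  simp [rho]

theorem momentIntegrand_one (n : ℕ) (u : ℝ) :
    momentIntegrand 1 n u
      = Real.pi / 2 * (((u : ℂ) * I + (-1 / 2 : ℝ)) ^ n / Complex.cosh (Real.pi * u) ^ 2) := by
  rw [momentIntegrand, rho_one_eq]
  push_cast
  ring

theorem integrable_momentIntegrand_one (n : ℕ) : Integrable (momentIntegrand 1 n) := by
  simp_rw [funext (momentIntegrand_one n)]
  exact (integrable_pow_div_cosh_sq (-1 / 2) (by norm_num [abs_le]) n).const_mul _

theorem continuous_momentIntegrand_one (n : ℕ) : Continuous (momentIntegrand 1 n) := by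
  simp_rw [funext (momentIntegrand_one n)]
  refine continuous_const.mul (Continuous.div (by fun_prop) (by fun_prop) fun u => ?_)
  exact pow_ne_zero _ (cosh_pi_mul_ne_zero u)

theorem exists_norm_momentIntegrand_one_le (n : ℕ) : ∃ C, ∀ u, ‖momentIntegrand 1 n u‖ ≤ C := by
  obtain ⟨C, hC0, hC⟩ := exists_one_add_abs_pow_div_cosh_sq_le n
  refine ⟨Real.pi / 2 * C, fun u => ?_⟩
  rw [momentIntegrand_one, norm_mul, norm_div, norm_div, norm_pow (Complex.cosh _), ← ofReal_mul,
    ← ofReal_cosh, norm_real, norm_real, Real.norm_eq_abs, Real.norm_eq_abs, sq_abs,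
    abs_of_pos Real.pi_pos, Complex.norm_ofNat]
  gcongr
  have h1 := norm_ofReal_mul_I_add_pow_le (-1 / 2) u (by norm_num [abs_le]) n
  have h2 : (1 + u ^ 2)⁻¹ ≤ 1 := inv_le_one_of_one_le₀ (by nlinarith [sq_nonneg u])
  calc _ ≤ (1 + |u|) ^ n / Real.cosh (Real.pi * u) ^ 2 := by gcongr
    _ ≤ C * (1 + u ^ 2)⁻¹ := hC u
    _ ≤ C * 1 := by gcongr
    _ = C := mul_one C

theorem integral_rho_one : ∫ u : ℝ, rho 1 u = 1 := by
  -- `(π/2) sech²(πu) = 2π e^{2πu} / (e^{2πu} + 1)²` has an elementary antiderivative.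
  have hderiv : ∀ u : ℝ,
      HasDerivAt (fun u => -(Real.exp (2 * Real.pi * u) + 1)⁻¹) (rho 1 u) u := by
    intro u
    have h := (((((hasDerivAt_id u).const_mul (2 * Real.pi)).exp).add_const 1).inv
      (by positivity)).neg
    refine h.congr_deriv ?_
    have he : Real.exp (2 * Real.pi * u) = Real.exp (Real.pi * u) ^ 2 := by
      rw [← Real.exp_nat_mul]
      congr 1
      push_cast
      ring
    have := Real.exp_pos (Real.pi * u)
    simp only [rho, id, he, Real.cosh_eq, Real.exp_neg]
    field_simp
  have hint : Integrable (rho 1) := by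
    have := (integrable_momentIntegrand_one 0).re
    simpa [momentIntegrand] using this
  have hpi : 0 < 2 * Real.pi := by positivity
  have htop : Tendsto (fun u => -(Real.exp (2 * Real.pi * u) + 1)⁻¹) atTop (𝓝 (-0)) :=
    (tendsto_atTop_add_const_right _ _
      (Real.tendsto_exp_atTop.comp (tendsto_id.const_mul_atTop hpi))).inv_tendsto_atTop.neg
  have hbot : Tendsto (fun u => -(Real.exp (2 * Real.pi * u) + 1)⁻¹) atBot (𝓝 (-(0 + 1)⁻¹)) :=
    (((Real.tendsto_exp_atBot.comp (tendsto_id.const_mul_atBot hpi)).add_const 1).inv₀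
      (by norm_num)).neg
  rw [integral_of_hasDerivAt_of_tendsto hderiv hint hbot htop]
  norm_num

/-- Adding `1` moves `iu - 1/2` to `iu + 1/2`, so the contour shift settles `n ≥ 2`; `n = 1` is the
total mass of `ρ_1`. -/
theorem integral_shift_momentIntegrand_one (n : ℕ) :
    ∫ u : ℝ, (((u : ℂ) * I - (1 : ℕ) / 2 + 1) ^ n - ((u : ℂ) * I - (1 : ℕ) / 2) ^ n) * (rho 1 u : ℂ)
      = if n = 1 then 1 else 0 := by
  rcases n with _ | _ | m
  · simp
  · simp only [zero_add, pow_one, add_sub_cancel_left, one_mul, if_true]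
    rw [integral_complex_ofReal, integral_rho_one, ofReal_one]
  · rw [if_neg (by lia)]
    have h := integral_shift_pow_div_cosh_sq m
    have hr := (integrable_pow_div_cosh_sq (1 / 2) (by norm_num [abs_le]) (m + 2))
    have hl := (integrable_pow_div_cosh_sq (-1 / 2) (by norm_num [abs_le]) (m + 2))
    have : ∀ u : ℝ, (((u : ℂ) * I - (1 : ℕ) / 2 + 1) ^ (m + 2)
          - ((u : ℂ) * I - (1 : ℕ) / 2) ^ (m + 2)) * (rho 1 u : ℂ)
        = Real.pi / 2 * (((u : ℂ) * I + (1 / 2 : ℝ)) ^ (m + 2) / Complex.cosh (Real.pi * u) ^ 2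
          - ((u : ℂ) * I + (-1 / 2 : ℝ)) ^ (m + 2) / Complex.cosh (Real.pi * u) ^ 2) := by
      intro u
      rw [rho_one_eq, show (u : ℂ) * I - (1 : ℕ) / 2 + 1 = u * I + (1 / 2 : ℝ) by push_cast; ring,
        show (u : ℂ) * I - (1 : ℕ) / 2 = u * I + (-1 / 2 : ℝ) by push_cast; ring]
      ring
    simp_rw [this]
    rw [integral_const_mul, integral_sub hr hl, h, sub_self, mul_zero]

theorem sum_choose_mul_integral_momentIntegrand_one (n : ℕ) :
    ∑ k ∈ Finset.range n, (n.choose k : ℂ) * ∫ u, momentIntegrand 1 k u = if n = 1 then 1 else 0 := by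
  rw [← integral_shift_momentIntegrand_one n]
  simp_rw [← integral_const_mul]
  rw [← integral_finsetSum _ fun k _ => (integrable_momentIntegrand_one k).const_mul _]
  refine integral_congr_ae (ae_of_all _ fun u => ?_)
  simp only [momentIntegrand]
  rw [add_pow, Finset.sum_range_succ]
  simp only [one_pow, mul_one, Nat.choose_self, Nat.cast_one, add_sub_cancel_right, Finset.sum_mul]
  exact Finset.sum_congr rfl fun k _ => by ring

/-- `t / (e^t - 1)` over the complex numbers. -/
def toddC : ℂ⟦X⟧ := PowerSeries.map (algebraMap ℝ ℂ) todd

/-- After multiplication by `e^t - 1`, comparing coefficients is exactly the Bernoulli recurrence.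
-/
theorem mk_integral_momentIntegrand_one :
    (PowerSeries.mk fun n => (∫ u, momentIntegrand 1 n u) / n.factorial) = toddC := by
  have hexp : toddC * (PowerSeries.exp ℂ - 1) = PowerSeries.X := by
    have := congrArg (PowerSeries.map (algebraMap ℝ ℂ)) todd_mul_exp_sub_one
    simpa [toddC, PowerSeries.map_exp] using this
  have hne : (PowerSeries.exp ℂ - 1) ≠ 0 := by
    intro h
    rw [h, mul_zero] at hexp
    exact PowerSeries.X_ne_zero hexp.symm
  apply mul_right_cancel₀ hne
  rw [hexp]
  ext n
  rw [PowerSeries.coeff_mul, Finset.Nat.sum_antidiagonal_eq_sum_range_succ_mk,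
    Finset.sum_range_succ, PowerSeries.coeff_X]
  have hn : (n.factorial : ℂ) ≠ 0 := by exact_mod_cast n.factorial_ne_zero
  have h := sum_choose_mul_integral_momentIntegrand_one n
  have hl : ∀ k ∈ Finset.range n,
      PowerSeries.coeff k (PowerSeries.mk fun n => (∫ u, momentIntegrand 1 n u) / n.factorial)
        * PowerSeries.coeff (n - k) (PowerSeries.exp ℂ - 1)
      = ((n.choose k : ℂ) * ∫ u, momentIntegrand 1 k u) / n.factorial := by
    intro k hk
    have hk := Finset.mem_range.1 hk
    rw [map_sub, PowerSeries.coeff_one, if_neg (by lia), PowerSeries.coeff_exp, PowerSeries.coeff_mk,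
      Nat.cast_choose ℂ hk.le]
    simp
    field_simp
  rw [Finset.sum_congr rfl hl, ← Finset.sum_div, h]
  split_ifs with h1 <;> simp [h1]

/-- Split `ix - (ℓ+1)/2 = (iu - ℓ/2) + (i(x-u) - 1/2)` and expand by the binomial theorem under the
convolution integral. -/
theorem momentIntegrand_succ {ℓ : ℕ} (hℓ : 1 ≤ ℓ)
    (hint : ∀ n, Integrable (momentIntegrand ℓ n)) (n : ℕ) (x : ℝ) :
    momentIntegrand (ℓ + 1) n x = ∑ k ∈ Finset.range (n + 1), (n.choose k : ℂ) *
      convolution (momentIntegrand ℓ k) (momentIntegrand 1 (n - k)) (ContinuousLinearMap.mul ℝ ℂ)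
        volume x := by
  obtain ⟨j, rfl⟩ : ∃ k, ℓ = k + 1 := ⟨ℓ - 1, by lia⟩
  -- Boundedness of the second factor gives integrability for every `x`, so the identity holds
  -- pointwise and not only almost everywhere.
  have hprod : ∀ k m, Integrable fun u => momentIntegrand (j + 1) k u * momentIntegrand 1 m (x - u) := by
    intro k m
    obtain ⟨C, hC⟩ := exists_norm_momentIntegrand_one_le m
    refine (hint k).mul_bdd (c := C) ?_ (ae_of_all _ fun u => hC _)
    exact ((continuous_momentIntegrand_one m).comp (by fun_prop)).aestronglyMeasurable
  simp only [convolution, ContinuousLinearMap.mul_apply', ← integral_const_mul]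
  rw [← integral_finsetSum _ fun k _ => (hprod k (n - k)).const_mul _]
  rw [momentIntegrand, rho, ← integral_complex_ofReal, ← integral_const_mul]
  refine integral_congr_ae (ae_of_all _ fun u => ?_)
  simp only [momentIntegrand]
  have : (x : ℂ) * I - ((j + 1 + 1 : ℕ) : ℂ) / 2
      = ((u : ℂ) * I - ((j + 1 : ℕ) : ℂ) / 2) + (((x - u : ℝ) : ℂ) * I - ((1 : ℕ) : ℂ) / 2) := by
    push_cast; ring
  rw [this, add_pow, Finset.sum_mul]
  refine Finset.sum_congr rfl fun k _ => ?_
  push_cast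
  ring

/-- The integral of a convolution is the product of the integrals, so the binomial sum becomes a
product of exponential generating functions. Integrability is needed at each step, hence the joint
induction. -/
theorem integrable_momentIntegrand_and_mk_integral {ℓ : ℕ} (hℓ : 1 ≤ ℓ) :
    (∀ n, Integrable (momentIntegrand ℓ n)) ∧
      (PowerSeries.mk fun n => (∫ u, momentIntegrand ℓ n u) / n.factorial) = toddC ^ ℓ := by
  induction ℓ, hℓ using Nat.le_induction with
  | base => exact ⟨integrable_momentIntegrand_one, by
      rw [pow_one]; exact mk_integral_momentIntegrand_one⟩
  | succ ℓ hℓ ih =>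
    obtain ⟨hint, hmk⟩ := ih
    have hconv : ∀ n k : ℕ, Integrable (convolution (momentIntegrand ℓ k)
        (momentIntegrand 1 (n - k)) (ContinuousLinearMap.mul ℝ ℂ) volume) := fun n k =>
      (hint k).integrable_convolution _ (integrable_momentIntegrand_one (n - k))
    refine ⟨fun n => ?_, ?_⟩
    · simp_rw [funext (momentIntegrand_succ hℓ hint n)]
      exact integrable_finsetSum _ fun k _ => (hconv n k).const_mul _
    · rw [pow_succ, ← hmk, ← mk_integral_momentIntegrand_one]
      ext n
      rw [PowerSeries.coeff_mul, Finset.Nat.sum_antidiagonal_eq_sum_range_succ_mk,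
        PowerSeries.coeff_mk]
      simp_rw [momentIntegrand_succ hℓ hint n]
      rw [integral_finsetSum _ fun k _ => (hconv n k).const_mul _, Finset.sum_div]
      refine Finset.sum_congr rfl fun k hk => ?_
      have hk : k ≤ n := by simpa [Nat.lt_succ_iff] using hk
      rw [integral_const_mul, integral_convolution _ (hint k) (integrable_momentIntegrand_one _),
        Nat.cast_choose ℂ hk, PowerSeries.coeff_mk, PowerSeries.coeff_mk]
      have hn : (n.factorial : ℂ) ≠ 0 := by exact_mod_cast n.factorial_ne_zero
      simp only [ContinuousLinearMap.mul_apply']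
      field_simp

theorem integrable_momentIntegrand {ℓ : ℕ} (hℓ : 1 ≤ ℓ) (n : ℕ) :
    Integrable (momentIntegrand ℓ n) :=
  (integrable_momentIntegrand_and_mk_integral hℓ).1 n

/-- The Nörlund numbers are the moments of `iu - ℓ/2` with respect to `ρ_ℓ`. -/
theorem integral_momentIntegrand {ℓ : ℕ} (hℓ : 1 ≤ ℓ) (n : ℕ) :
    ∫ u, momentIntegrand ℓ n u = (norlund ℓ n : ℂ) := by
  have h := congrArg (PowerSeries.coeff n) (integrable_momentIntegrand_and_mk_integral hℓ).2
  have hn : (n.factorial : ℂ) ≠ 0 := by exact_mod_cast n.factorial_ne_zero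
  rw [PowerSeries.coeff_mk, toddC, ← map_pow, PowerSeries.coeff_map, div_eq_iff hn] at h
  rw [h, norlund]
  push_cast
  rw [mul_comm]
  rfl

theorem integrable_rho {ℓ : ℕ} (hℓ : 1 ≤ ℓ) : Integrable (rho ℓ) := by
  have := (integrable_momentIntegrand hℓ 0).re
  simpa [momentIntegrand] using this

theorem integral_rho {ℓ : ℕ} (hℓ : 1 ≤ ℓ) : ∫ u, rho ℓ u = 1 := by
  have h := integral_momentIntegrand hℓ 0
  simp only [momentIntegrand, pow_zero, one_mul, norlund, Nat.factorial_zero, Nat.cast_one] at h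
  rw [integral_complex_ofReal] at h
  have h' := ofReal_injective h
  rw [h', PowerSeries.coeff_zero_eq_constantCoeff_apply, map_pow, todd,
    PowerSeries.constantCoeff_inv, ← PowerSeries.coeff_zero_eq_constantCoeff_apply]
  simp

theorem integrable_pow_mul_rho {ℓ : ℕ} (hℓ : 1 ≤ ℓ) (n : ℕ) :
    Integrable fun u : ℝ => u ^ n * rho ℓ u := by
  refine (integrable_momentIntegrand hℓ n).norm.mono' ?_ (ae_of_all _ fun u => ?_)
  · exact (by fun_prop : Continuous fun u : ℝ => u ^ n).aestronglyMeasurable.mul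
      (integrable_rho hℓ).aestronglyMeasurable
  · rw [momentIntegrand, norm_mul, norm_mul, norm_real, norm_pow, norm_pow]
    gcongr
    -- `|u|` is the size of the imaginary part of `iu - ℓ/2`.
    have := Complex.abs_im_le_norm ((u : ℂ) * I - ℓ / 2)
    simpa using this

end

end Norlund

/-! ### Formal logarithms and the Chebyshev generating function. -/

namespace Norlund

noncomputable section

section FormalLog

open PowerSeries

/-- `X^k` divides `g^k`, so powers beyond `n` do not contribute. The free cutoff `N` lets all
coefficients up to `N` share one finite sum. -/
theorem coeff_logOf_one_add {K : Type*} [Field K] [Algebra ℚ K] {g : K⟦X⟧}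
    (hg : constantCoeff g = 0) {n N : ℕ} (hn : n ≤ N) :
    coeff n (logOf (1 + g))
      = ∑ k ∈ Finset.Icc 1 N, (-1) ^ (k + 1) / (k : K) * coeff n (g ^ k) := by
  rw [logOf_eq, add_sub_cancel_left, coeff_subst' (HasSubst.of_constantCoeff_zero' hg),
    finsum_eq_sum_of_support_subset (s := Finset.Icc 1 N)]
  · refine Finset.sum_congr rfl fun k hk => ?_
    rw [coeff_log, if_neg (by have := (Finset.mem_Icc.1 hk).1; lia)]
    simp
  · intro k hk
    simp only [Function.mem_support] at hk
    rw [Finset.mem_coe, Finset.mem_Icc]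
    by_contra hkN
    apply hk
    by_cases h0 : k = 0
    · simp [h0]
    · refine smul_eq_zero_of_right _ (coeff_of_lt_order _ ?_)
      have hX : X ^ k ∣ g ^ k := pow_dvd_pow_of_dvd (X_dvd_iff.2 hg) k
      refine lt_of_lt_of_le ?_ (le_order _ k fun i hi => X_pow_dvd_iff.1 hX i (by exact_mod_cast hi))
      exact_mod_cast (by lia : n < k)

theorem map_logOf {K L : Type*} [Field K] [Algebra ℚ K] [Field L] [Algebra ℚ L] (φ : K →+* L)
    {f : K⟦X⟧} (hf : constantCoeff f = 1) : map φ (logOf f) = logOf (map φ f) := by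
  obtain ⟨g, rfl⟩ : ∃ g, f = 1 + g := ⟨f - 1, by ring⟩
  have hg : constantCoeff g = 0 := by simpa using hf
  ext n
  have hg' : constantCoeff (map φ g) = 0 := by
    rw [← coeff_zero_eq_constantCoeff_apply, coeff_map, coeff_zero_eq_constantCoeff_apply, hg,
      map_zero]
  rw [coeff_map, map_add, map_one, coeff_logOf_one_add hg le_rfl,
    coeff_logOf_one_add hg' le_rfl, map_sum]
  refine Finset.sum_congr rfl fun k _ => ?_
  rw [map_mul, map_div₀, map_pow, map_neg, map_one, map_natCast, ← coeff_map, map_pow]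

theorem mul_derivative_logOf {K : Type*} [Field K] [Algebra ℚ K] {f : K⟦X⟧}
    (hf : constantCoeff f = 1) : f * d⁄dX K (logOf f) = d⁄dX K f := by
  have hs : HasSubst (f - 1) := HasSubst.of_constantCoeff_zero' (by simp [hf])
  have hgeom : (1 + X) * d⁄dX K (log K) = 1 := by
    rw [deriv_log, add_mul, one_mul]
    ext n
    rcases n with _ | n
    · simp
    · simp [coeff_succ_X_mul, coeff_one, pow_succ]
  have h := congrArg (subst (f - 1)) hgeom
  rw [subst_mul hs, subst_add hs, subst_X hs, ← coe_substAlgHom hs, map_one,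
    coe_substAlgHom hs] at h
  rw [logOf_eq, derivative_subst hs, ← mul_assoc]
  rw [add_sub_cancel] at h
  rw [h]
  simp

theorem logOf_mul {K : Type*} [Field K] [Algebra ℚ K] {f g : K⟦X⟧}
    (hf : constantCoeff f = 1) (hg : constantCoeff g = 1) :
    logOf (f * g) = logOf f + logOf g := by
  have : CharZero K := algebraRat.charZero K
  have hfg : constantCoeff (f * g) = 1 := by simp [hf, hg]
  refine derivative.ext ?_ ?_
  · have hne : f * g ≠ 0 := by
      intro h
      rw [h] at hfg
      simp at hfg
    apply mul_left_cancel₀ hne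
    rw [mul_derivative_logOf hfg, map_add, mul_add, mul_right_comm f g, mul_derivative_logOf hf,
      mul_assoc f g, mul_derivative_logOf hg, Derivation.leibniz]
    simp only [smul_eq_mul]
    ring
  · rw [map_add, constantCoeff_logOf hf, constantCoeff_logOf hg, constantCoeff_logOf hfg, add_zero]

/-- `∑_{r ≤ n} binom(n+r, 2r) w^r / (n+r)`, which equals `T_n(1 + w/2) / n`. -/
def modPoly {K : Type*} [Field K] (n : ℕ) (w : K) : K :=
  ∑ r ∈ Finset.range (n + 1), ((n + r).choose (2 * r) : K) * (w ^ r / ((n : K) + r))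

/-- Write `2(n+1) = (n+1+r) + (n+1-r)` and absorb `n+1-r` into the binomial coefficient; this
removes the denominators before the recurrence is proved. -/
theorem two_mul_mul_choose_div {K : Type*} [Field K] [CharZero K] (n r : ℕ) :
    2 * ((n : K) + 1) * (((n + 1 + r).choose (2 * r) : K) / ((n + 1 : ℕ) + r))
      = ((n + 1 + r).choose (2 * r) : K) + ((n + r).choose (2 * r) : K) := by
  have hne : ((n + 1 : ℕ) : K) + r ≠ 0 := by
    norm_cast; lia
  rcases le_or_gt r (n + 1) with h | h
  · have h1 := Nat.choose_mul_succ_eq (n + r) (2 * r)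
    have h1' : ((n + r).choose (2 * r) : K) * ((n + 1 : ℕ) + r)
        = ((n + 1 + r).choose (2 * r) : K) * ((n + 1 : ℕ) - r) := by
      have h2 : n + r + 1 - 2 * r = n + 1 - r := by lia
      rw [h2, show n + r + 1 = n + 1 + r by ring] at h1
      have := congrArg (Nat.cast (R := K)) h1
      rw [Nat.cast_mul, Nat.cast_mul, Nat.cast_sub h, Nat.cast_add (n + 1) r] at this
      exact this
    field_simp
    push_cast at h1' ⊢
    linear_combination -h1'
  · rw [Nat.choose_eq_zero_of_lt (by lia), Nat.choose_eq_zero_of_lt (by lia)]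
    simp

theorem two_mul_mul_modPoly {K : Type*} [Field K] [CharZero K] (n N : ℕ) (hN : n + 1 ≤ N) (w : K) :
    2 * ((n : K) + 1) * modPoly (n + 1) w
      = ∑ r ∈ Finset.range (N + 1),
        (((n + 1 + r).choose (2 * r) : K) + ((n + r).choose (2 * r) : K)) * w ^ r := by
  rw [modPoly, Finset.mul_sum]
  rw [← Finset.sum_subset (Finset.range_mono (by lia : n + 1 + 1 ≤ N + 1))]
  · refine Finset.sum_congr rfl fun r _ => ?_
    rw [← two_mul_mul_choose_div]
    ring
  · intro r _ hr
    rw [Finset.mem_range] at hr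
    rw [Nat.choose_eq_zero_of_lt (by lia), Nat.choose_eq_zero_of_lt (by lia)]
    simp

theorem choose_second_difference (m k : ℕ) :
    (m + 2).choose (k + 2) + m.choose (k + 2) = 2 * (m + 1).choose (k + 2) + m.choose k := by
  have h1 := Nat.choose_succ_succ (m + 1) (k + 1)
  have h2 := Nat.choose_succ_succ m (k + 1)
  have h3 := Nat.choose_succ_succ m k
  simp only [Nat.succ_eq_add_one] at h1 h2 h3
  lia

/-- The Chebyshev recurrence for `n · modPoly n`. Coefficientwise it is the second difference of
binomial coefficients in the upper index. -/
theorem modPoly_recurrence {K : Type*} [Field K] [CharZero K] (n : ℕ) (w : K) :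
    ((n : K) + 3) * modPoly (n + 3) w
      = (2 + w) * (((n : K) + 2) * modPoly (n + 2) w) - ((n : K) + 1) * modPoly (n + 1) w := by
  have h3 := two_mul_mul_modPoly (n + 2) (n + 3) le_rfl w
  have h2 := two_mul_mul_modPoly (n + 1) (n + 3) (by lia) w
  have h2' := two_mul_mul_modPoly (n + 1) (n + 2) le_rfl w
  have h1 := two_mul_mul_modPoly n (n + 3) (by lia) w
  rw [Finset.sum_range_succ'] at h3 h2 h1
  push_cast at h1 h2 h2' h3
  have key : ∀ r : ℕ,
      (((n + 2 + 1 + (r + 1)).choose (2 * (r + 1)) : K) + ((n + 2 + (r + 1)).choose (2 * (r + 1)) : K))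
        * w ^ (r + 1)
      = 2 * ((((n + 1 + 1 + (r + 1)).choose (2 * (r + 1)) : K)
          + ((n + 1 + (r + 1)).choose (2 * (r + 1)) : K)) * w ^ (r + 1))
        + w * ((((n + 1 + 1 + r).choose (2 * r) : K) + ((n + 1 + r).choose (2 * r) : K)) * w ^ r)
        - (((n + 1 + (r + 1)).choose (2 * (r + 1)) : K)
          + ((n + (r + 1)).choose (2 * (r + 1)) : K)) * w ^ (r + 1) := by
    intro r
    have e1 := congrArg (Nat.cast (R := K)) (choose_second_difference (n + 2 + r) (2 * r))
    have e2 := congrArg (Nat.cast (R := K)) (choose_second_difference (n + 1 + r) (2 * r))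
    push_cast at e1 e2
    simp only [show n + 2 + 1 + (r + 1) = n + 2 + r + 2 by ring,
      show n + 2 + (r + 1) = n + 1 + r + 2 by ring,
      show n + 1 + (r + 1) = n + 1 + r + 1 by ring, show n + 1 + 1 + r = n + 2 + r by ring,
      show n + (r + 1) = n + 1 + r by ring, show 2 * (r + 1) = 2 * r + 2 by ring] at *
    simp only [show n + 1 + r + 2 = n + 2 + r + 1 by ring, show n + 1 + r + 1 = n + 2 + r by ring]
      at *
    linear_combination w ^ (r + 1) * (e1 + e2)
  rw [Finset.sum_congr rfl fun r _ => key r, Finset.sum_sub_distrib, Finset.sum_add_distrib,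
    ← Finset.mul_sum, ← Finset.mul_sum, ← h2'] at h3
  have h20 : (2 : K) ≠ 0 := two_ne_zero
  apply mul_left_cancel₀ h20
  simp at h1 h2 h3
  linear_combination h3 - 2 * h2 + h1

/-- Differentiate and clear the quadratic: coefficients from degree `2` on are the three-term
recurrence, degrees `0` and `1` are computed directly. -/
theorem mk_modPoly_eq_logOf {K : Type*} [Field K] [Algebra ℚ K] (w : K) :
    (PowerSeries.mk fun n => if n = 0 then 0 else modPoly n w)
      = (-(1 / 2) : K) • logOf (1 - C (2 + w) * X + X ^ 2) := by
  have : CharZero K := algebraRat.charZero K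
  obtain ⟨c, hc⟩ : ∃ c : K, c = 2 + w := ⟨_, rfl⟩
  rw [← hc]
  have hQ : constantCoeff (1 - C c * X + X ^ 2 : K⟦X⟧) = 1 := by simp
  refine derivative.ext ?_ ?_
  · have hne : (1 - C c * X + X ^ 2 : K⟦X⟧) ≠ 0 := by
      intro h
      rw [h] at hQ
      simp at hQ
    apply mul_left_cancel₀ hne
    rw [Derivation.map_smul, mul_smul_comm, mul_derivative_logOf hQ]
    have hd : d⁄dX K (1 - C c * X + X ^ 2 : K⟦X⟧) = X + X - C c := by
      rw [sq]
      simp [Derivation.leibniz]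
      ring
    have hm : d⁄dX K (PowerSeries.mk fun n => if n = 0 then 0 else modPoly n w)
        = PowerSeries.mk fun n => ((n : K) + 1) * modPoly (n + 1) w := by
      ext n
      simp [coeff_derivative, mul_comm]
    have expand : ∀ f : K⟦X⟧, (1 - C c * X + X ^ 2 : K⟦X⟧) * f
        = f - C c * (X * f) + X * (X * f) := fun f => by ring
    have h20 : (2 : K) ≠ 0 := two_ne_zero
    have h30 : (3 : K) ≠ 0 := three_ne_zero
    rw [hd, hm, expand]
    ext n
    rcases n with _ | _ | n
    · simp [modPoly, Finset.sum_range_succ, hc]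
      field_simp
      ring
    · simp [coeff_succ_X_mul, coeff_C_mul]
      simp [modPoly, Finset.sum_range_succ, Nat.choose, hc]
      field_simp
      ring
    · have hr := modPoly_recurrence n w
      rw [← hc] at hr
      simp [coeff_succ_X_mul, coeff_C_mul, coeff_X]
      ring_nf at hr ⊢
      linear_combination hr
  · rw [← coeff_zero_eq_constantCoeff_apply, ← coeff_zero_eq_constantCoeff_apply, coeff_smul,
      coeff_zero_eq_constantCoeff_apply (logOf _), constantCoeff_logOf hQ]
    simp

end FormalLog

end

end Norlund

/-! ### The identity of formal power series. -/

namespace Norlund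

noncomputable section

open MeasureTheory Complex

section GeneratingFunction

open PowerSeries

theorem constantCoeff_qSeries (ℓ : ℕ) : constantCoeff (qSeries ℓ) = 1 := by simp [qSeries]

theorem constantCoeff_bSeries (ℓ : ℕ) : constantCoeff (bSeries ℓ) = 0 := by simp [bSeries]

theorem coeff_logOf_one_add_bSeries (ℓ : ℕ) {n N : ℕ} (hn : n ≤ N) (u : ℝ) :
    coeff n (logOf (1 + bSeries ℓ * C (u ^ 2)))
      = ∑ k ∈ Finset.Icc 1 N,
          (-1) ^ (k + 1) / (k : ℝ) * coeff n (bSeries ℓ ^ k) * u ^ (2 * k) := by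
  rw [coeff_logOf_one_add (by simp [constantCoeff_bSeries]) hn]
  refine Finset.sum_congr rfl fun k _ => ?_
  rw [mul_pow, ← map_pow, coeff_mul_C, ← pow_mul, mul_assoc]

theorem integrable_coeff_logOf_mul_rho {ℓ : ℕ} (hℓ : 1 ≤ ℓ) (n : ℕ) :
    Integrable fun u : ℝ => coeff n (logOf (1 + bSeries ℓ * C (u ^ 2))) * rho ℓ u := by
  simp_rw [coeff_logOf_one_add_bSeries ℓ le_rfl, Finset.sum_mul, mul_assoc]
  refine integrable_finsetSum _ fun k _ => ?_
  exact ((integrable_pow_mul_rho hℓ (2 * k)).const_mul _).const_mul _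

/-- The two quadratics are `q - iuX` and `q + iuX`, with real product `q²(1 + b u²)`; the formal
logarithm turns the product into a sum. -/
theorem modPoly_add_modPoly_conj (ℓ n : ℕ) (hn : n ≠ 0) (u : ℝ) :
    modPoly n ((u : ℂ) * I - ℓ / 2) + modPoly n (-((u : ℂ) * I) - ℓ / 2)
      = ((-coeff n (logOf (qSeries ℓ))
          - 1 / 2 * coeff n (logOf (1 + bSeries ℓ * C (u ^ 2))) : ℝ) : ℂ) := by
  have hQ : ∀ w : ℂ, constantCoeff (1 - C (2 + w) * X + X ^ 2 : ℂ⟦X⟧) = 1 := fun w => by simp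
  have hP : ∀ w : ℂ, modPoly n w = -(1 / 2) * coeff n (logOf (1 - C (2 + w) * X + X ^ 2)) := by
    intro w
    have := congrArg (coeff n) (mk_modPoly_eq_logOf w)
    rwa [coeff_mk, if_neg hn, coeff_smul, smul_eq_mul] at this
  have hq := constantCoeff_qSeries ℓ
  have hb : constantCoeff (1 + bSeries ℓ * C (u ^ 2)) = 1 := by simp [constantCoeff_bSeries]
  have hprodR : qSeries ℓ * qSeries ℓ * (1 + bSeries ℓ * C (u ^ 2))
      = qSeries ℓ ^ 2 + X ^ 2 * C (u ^ 2) := by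
    have hq2 : constantCoeff (qSeries ℓ ^ 2) ≠ 0 := by simp [hq]
    have := PowerSeries.mul_inv_cancel _ hq2
    rw [bSeries]
    linear_combination (X ^ 2 * C (u ^ 2)) * this
  have hCI : (C (I * I) : ℂ⟦X⟧) = -1 := by rw [I_mul_I, map_neg, map_one]
  have hprod : (1 - C (2 + ((u : ℂ) * I - ℓ / 2)) * X + X ^ 2 : ℂ⟦X⟧)
        * (1 - C (2 + (-((u : ℂ) * I) - ℓ / 2)) * X + X ^ 2)
      = map (algebraMap ℝ ℂ) (qSeries ℓ * qSeries ℓ * (1 + bSeries ℓ * C (u ^ 2))) := by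
    rw [hprodR]
    have hcast : (((ℓ : ℝ) / 2 : ℝ) : ℂ) = (ℓ : ℂ) / 2 := by push_cast; rfl
    have hC2 : (C 2 : ℂ⟦X⟧) = 2 := map_ofNat C 2
    simp only [qSeries, map_add, map_mul, map_pow, map_one, map_X, map_C, map_sub, map_neg,
      ofReal_ofNat, hcast, hC2, coe_algebraMap] at hCI ⊢
    linear_combination (-(X ^ 2 * C (u : ℂ) ^ 2)) * hCI
  have hlog := congrArg (coeff n) (congrArg logOf hprod)
  rw [logOf_mul (hQ _) (hQ _), ← map_logOf (algebraMap ℝ ℂ) (by simp [hq, constantCoeff_bSeries]),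
    logOf_mul (by simp [hq]) hb, logOf_mul hq hq, coeff_map] at hlog
  rw [hP, hP]
  simp only [LinearMap.map_add, coe_algebraMap, ofReal_add] at hlog
  push_cast
  linear_combination (-(1 / 2)) * hlog

theorem re_modPoly (ℓ n : ℕ) (hn : n ≠ 0) (u : ℝ) :
    (modPoly n ((u : ℂ) * I - ℓ / 2)).re
      = -(1 / 2) * coeff n (logOf (qSeries ℓ))
          - 1 / 4 * coeff n (logOf (1 + bSeries ℓ * C (u ^ 2))) := by
  have h := modPoly_add_modPoly_conj ℓ n hn u
  have hconj : modPoly n (-((u : ℂ) * I) - ℓ / 2)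
      = (starRingEnd ℂ) (modPoly n ((u : ℂ) * I - ℓ / 2)) := by
    simp [modPoly, map_ofNat (starRingEnd ℂ) 2]
  rw [hconj, Complex.add_conj] at h
  have := ofReal_injective h
  linear_combination this / 2

theorem modNorlund_eq_integral {ℓ : ℕ} (hℓ : 1 ≤ ℓ) (n : ℕ) :
    modNorlund ℓ n = ∫ u : ℝ, (modPoly n ((u : ℂ) * I - ℓ / 2)).re * rho ℓ u := by
  have hpt : ∀ u : ℝ, modPoly n ((u : ℂ) * I - ℓ / 2) * (rho ℓ u : ℂ)
      = ∑ r ∈ Finset.range (n + 1),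
          (((n + r).choose (2 * r) : ℂ) / ((n : ℂ) + r)) * momentIntegrand ℓ r u := by
    intro u
    rw [modPoly, Finset.sum_mul]
    refine Finset.sum_congr rfl fun r _ => ?_
    rw [momentIntegrand]
    ring
  have hint : Integrable fun u : ℝ => modPoly n ((u : ℂ) * I - ℓ / 2) * (rho ℓ u : ℂ) := by
    simp_rw [hpt]
    exact integrable_finsetSum _ fun r _ => (integrable_momentIntegrand hℓ r).const_mul _
  have hval : ∫ u : ℝ, modPoly n ((u : ℂ) * I - ℓ / 2) * (rho ℓ u : ℂ) = (modNorlund ℓ n : ℂ) := by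
    simp_rw [hpt]
    rw [integral_finsetSum _ fun r _ => (integrable_momentIntegrand hℓ r).const_mul _, modNorlund]
    push_cast
    refine Finset.sum_congr rfl fun r _ => ?_
    rw [integral_const_mul, integral_momentIntegrand hℓ]
    ring
  have := congrArg Complex.re hval
  rw [ofReal_re] at this
  rw [← this]
  have h2 := reCLM.integral_comp_comm hint
  rw [reCLM_apply] at h2
  rw [← h2]
  refine integral_congr_ae (ae_of_all _ fun u => ?_)
  simp

theorem genFun_eq {ℓ : ℕ} (hℓ : 1 ≤ ℓ) :
    genFun ℓ = (-(1 / 2) : ℝ) • logOf (qSeries ℓ) - (1 / 2 : ℝ) • logMomentSeries ℓ := by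
  ext n
  rw [genFun, coeff_mk, map_sub, coeff_smul, coeff_smul, logMomentSeries, coeff_mk, smul_eq_mul,
    smul_eq_mul]
  split_ifs with hn
  · subst hn
    have hb : ∀ u : ℝ, constantCoeff (1 + bSeries ℓ * C (u ^ 2)) = 1 := fun u => by
      simp [constantCoeff_bSeries]
    simp only [coeff_zero_eq_constantCoeff_apply, constantCoeff_logOf (hb _),
      constantCoeff_logOf (constantCoeff_qSeries ℓ)]
    simp
  · rw [modNorlund_eq_integral hℓ]
    simp_rw [re_modPoly ℓ n hn, sub_mul, mul_assoc]
    rw [integral_sub (((integrable_rho hℓ).const_mul _).const_mul _)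
      ((integrable_coeff_logOf_mul_rho hℓ n).const_mul _), integral_const_mul, integral_const_mul,
      integral_const_mul, integral_rho hℓ]
    -- The integrand is even, so the full line is twice the half line and the factor `1/4` becomes
    -- `1/2`.
    have heven := integral_comp_abs
      (f := fun u : ℝ => coeff n (logOf (1 + bSeries ℓ * C (u ^ 2))) * rho ℓ u)
    have habs : ∀ u : ℝ, rho ℓ |u| = rho ℓ u := fun u => by
      rcases abs_choice u with h | h <;> rw [h]
      exact rho_neg hℓ u
    simp only [sq_abs, habs] at heven
    rw [heven]
    ring

end GeneratingFunction

end

end Norlund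

/-! ### A calculus of asymptotic expansions at `0+`. -/

namespace Norlund

noncomputable section

open MeasureTheory Filter

/-- `f z` agrees with the formal power series `φ` up to `O(z ^ (N + 1))` as `z → 0+`. -/
def HasExpansion (N : ℕ) (f : ℝ → ℝ) (φ : ℝ⟦X⟧) : Prop :=
  ∃ P : Polynomial ℝ, PowerSeries.X ^ (N + 1) ∣ φ - (P : ℝ⟦X⟧) ∧
    (fun z => f z - P.eval z) =O[𝓝[>] 0] fun z : ℝ => z ^ (N + 1)

theorem isBigO_one_eval (P : Polynomial ℝ) :
    (fun z => P.eval z) =O[𝓝[>] 0] fun _ => (1 : ℝ) :=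
  ((P.continuous.tendsto 0).mono_left nhdsWithin_le_nhds).isBigO_one ℝ

theorem isBigO_pow_eval {n : ℕ} {P : Polynomial ℝ} (h : Polynomial.X ^ n ∣ P) :
    (fun z => P.eval z) =O[𝓝[>] 0] fun z : ℝ => z ^ n := by
  obtain ⟨S, rfl⟩ := h
  have := (isBigO_refl (fun z : ℝ => z ^ n) (𝓝[>] 0)).mul (isBigO_one_eval S)
  simpa using this

theorem X_pow_dvd_of_coe {n : ℕ} {P : Polynomial ℝ}
    (h : PowerSeries.X ^ n ∣ (P : ℝ⟦X⟧)) : Polynomial.X ^ n ∣ P := by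
  rw [Polynomial.X_pow_dvd_iff]
  intro d hd
  have := PowerSeries.X_pow_dvd_iff.1 h d hd
  rwa [Polynomial.coeff_coe] at this

theorem X_pow_dvd_sub_trunc (n : ℕ) (φ : ℝ⟦X⟧) :
    PowerSeries.X ^ n ∣ φ - (PowerSeries.trunc n φ : ℝ⟦X⟧) := by
  rw [PowerSeries.X_pow_dvd_iff]
  intro d hd
  rw [map_sub, Polynomial.coeff_coe, PowerSeries.coeff_trunc, if_pos hd, sub_self]

theorem isBigO_pow_of_le {m n : ℕ} (h : m ≤ n) :
    (fun z : ℝ => z ^ n) =O[𝓝[>] 0] fun z => z ^ m := by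
  simpa using isBigO_pow_eval (P := Polynomial.X ^ n) (pow_dvd_pow _ h)

namespace HasExpansion

variable {N : ℕ} {f g : ℝ → ℝ} {φ ψ : ℝ⟦X⟧}

theorem polynomial (N : ℕ) (P : Polynomial ℝ) :
    HasExpansion N (fun z => P.eval z) (P : ℝ⟦X⟧) :=
  ⟨P, by simp, by simp [isBigO_zero]⟩

theorem of_isBigO (h : f =O[𝓝[>] 0] fun z : ℝ => z ^ (N + 1)) : HasExpansion N f 0 :=
  ⟨0, by simp, by simpa using h⟩

theorem congr_left (hf : HasExpansion N f φ) (h : f =ᶠ[𝓝[>] 0] g) : HasExpansion N g φ := by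
  obtain ⟨P, hP, hO⟩ := hf
  exact ⟨P, hP, hO.congr' (h.mono fun z hz => by simp only [hz]) EventuallyEq.rfl⟩

theorem congr_right (hf : HasExpansion N f φ)
    (h : ∀ n ≤ N, PowerSeries.coeff n φ = PowerSeries.coeff n ψ) : HasExpansion N f ψ := by
  obtain ⟨P, hP, hO⟩ := hf
  refine ⟨P, ?_, hO⟩
  have : PowerSeries.X ^ (N + 1) ∣ ψ - φ := by
    rw [PowerSeries.X_pow_dvd_iff]
    intro d hd
    rw [map_sub, h d (by lia), sub_self]
  simpa using dvd_add this hP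

theorem add (hf : HasExpansion N f φ) (hg : HasExpansion N g ψ) :
    HasExpansion N (fun z => f z + g z) (φ + ψ) := by
  obtain ⟨P, hP, hfP⟩ := hf
  obtain ⟨Q, hQ, hgQ⟩ := hg
  refine ⟨P + Q, ?_, ?_⟩
  · have := dvd_add hP hQ
    rwa [show φ - (P : ℝ⟦X⟧) + (ψ - (Q : ℝ⟦X⟧)) = φ + ψ - ((P + Q : Polynomial ℝ) : ℝ⟦X⟧) by
      push_cast; ring] at this
  · refine (hfP.add hgQ).congr_left fun z => ?_
    rw [Polynomial.eval_add]
    ring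

theorem isBigO_one (hf : HasExpansion N f φ) : f =O[𝓝[>] 0] fun _ => (1 : ℝ) := by
  obtain ⟨P, -, hfP⟩ := hf
  have h1 : (fun z : ℝ => z ^ (N + 1)) =O[𝓝[>] 0] fun _ => (1 : ℝ) := by
    simpa using isBigO_pow_of_le (Nat.zero_le (N + 1))
  exact ((hfP.trans h1).add (isBigO_one_eval P)).congr_left fun z => by ring

theorem mul (hf : HasExpansion N f φ) (hg : HasExpansion N g ψ) :
    HasExpansion N (fun z => f z * g z) (φ * ψ) := by
  have hg1 := hg.isBigO_one
  obtain ⟨P, hP, hfP⟩ := hf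
  obtain ⟨Q, hQ, hgQ⟩ := hg
  refine ⟨P * Q, ?_, ?_⟩
  · have := dvd_add (hP.mul_right ψ) (hQ.mul_left (P : ℝ⟦X⟧))
    rwa [show (φ - (P : ℝ⟦X⟧)) * ψ + P * (ψ - (Q : ℝ⟦X⟧))
        = φ * ψ - ((P * Q : Polynomial ℝ) : ℝ⟦X⟧) by push_cast; ring] at this
  · have h1 := hfP.mul hg1
    have h2 := (isBigO_one_eval P).mul hgQ
    simp only [mul_one, one_mul] at h1 h2
    refine (h1.add h2).congr_left fun z => ?_
    rw [Polynomial.eval_mul]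
    ring

theorem const (N : ℕ) (c : ℝ) : HasExpansion N (fun _ => c) (PowerSeries.C c) := by
  simpa using polynomial N (Polynomial.C c)

theorem const_mul (c : ℝ) (hf : HasExpansion N f φ) :
    HasExpansion N (fun z => c * f z) (c • φ) := by
  rw [PowerSeries.smul_eq_C_mul]
  exact (const N c).mul hf

theorem pow (hf : HasExpansion N f φ) (k : ℕ) : HasExpansion N (fun z => f z ^ k) (φ ^ k) := by
  induction k with
  | zero => simpa using const N 1
  | succ k ih =>
    simp_rw [pow_succ]
    exact ih.mul hf

theorem sum {ι : Type*} (s : Finset ι) {F : ι → ℝ → ℝ} {Φ : ι → ℝ⟦X⟧}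
    (h : ∀ i ∈ s, HasExpansion N (F i) (Φ i)) :
    HasExpansion N (fun z => ∑ i ∈ s, F i z) (∑ i ∈ s, Φ i) := by
  classical
  induction s using Finset.induction_on with
  | empty => simpa using const N 0
  | insert a s ha ih =>
    simp_rw [Finset.sum_insert ha]
    exact (h a (by simp)).add (ih fun i hi => h i (by simp [hi]))

theorem tendsto (hf : HasExpansion N f φ) :
    Tendsto f (𝓝[>] 0) (𝓝 (PowerSeries.constantCoeff φ)) := by
  obtain ⟨P, hP, hfP⟩ := hf
  have hz : Tendsto (fun z : ℝ => z ^ (N + 1)) (𝓝[>] 0) (𝓝 0) := by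
    have := ((continuous_pow (N + 1)).tendsto (0 : ℝ)).mono_left
      (nhdsWithin_le_nhds (s := Set.Ioi 0))
    simpa using this
  have h1 := hfP.trans_tendsto hz
  have h2 := (P.continuous.tendsto 0).mono_left (nhdsWithin_le_nhds (s := Set.Ioi 0))
  have h0 := PowerSeries.X_pow_dvd_iff.1 hP 0 (by lia)
  rw [map_sub, Polynomial.coeff_coe, sub_eq_zero, PowerSeries.coeff_zero_eq_constantCoeff_apply,
    Polynomial.coeff_zero_eq_eval_zero] at h0
  rw [h0]
  simpa using h1.add h2

theorem inv (hf : HasExpansion N f φ) (hφ : PowerSeries.constantCoeff φ ≠ 0) :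
    HasExpansion N (fun z => (f z)⁻¹) φ⁻¹ := by
  have htend := hf.tendsto
  have hinv1 : (fun z => (f z)⁻¹) =O[𝓝[>] 0] fun _ => (1 : ℝ) := (htend.inv₀ hφ).isBigO_one ℝ
  obtain ⟨P, hP, hfP⟩ := hf
  set R := PowerSeries.trunc (N + 1) φ⁻¹
  have hR : PowerSeries.X ^ (N + 1) ∣ φ⁻¹ - (R : ℝ⟦X⟧) := X_pow_dvd_sub_trunc _ _
  refine ⟨R, hR, ?_⟩
  have hPR : Polynomial.X ^ (N + 1) ∣ 1 - P * R := by
    apply X_pow_dvd_of_coe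
    have := dvd_add (hP.mul_right φ⁻¹) (hR.mul_left (P : ℝ⟦X⟧))
    rwa [show (φ - (P : ℝ⟦X⟧)) * φ⁻¹ + P * (φ⁻¹ - (R : ℝ⟦X⟧))
        = ((1 - P * R : Polynomial ℝ) : ℝ⟦X⟧) by
      push_cast
      linear_combination PowerSeries.mul_inv_cancel φ hφ] at this
  have h1 := hfP.mul (isBigO_one_eval R)
  have h2 := isBigO_pow_eval hPR
  simp only [mul_one] at h1
  -- `1/f - R = (1/f) ((1 - P R) - (f - P) R)`, where both terms in the bracket are `O(z^(N+1))`.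
  have h3 := hinv1.mul (h2.sub h1)
  simp only [one_mul] at h3
  refine h3.congr' ?_ EventuallyEq.rfl
  filter_upwards [htend.eventually_ne hφ] with z hz
  simp only [Polynomial.eval_sub, Polynomial.eval_mul, Polynomial.eval_one]
  field_simp
  ring

theorem isBigO_self (hf : HasExpansion N f φ) (hφ : PowerSeries.constantCoeff φ = 0) :
    f =O[𝓝[>] 0] fun z : ℝ => z := by
  obtain ⟨P, hP, hfP⟩ := hf
  have h1 : (fun z : ℝ => z ^ (N + 1)) =O[𝓝[>] 0] fun z : ℝ => z := by
    simpa using isBigO_pow_of_le (Nat.succ_le_succ (Nat.zero_le N))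
  have hX : Polynomial.X ^ 1 ∣ P := by
    rw [pow_one, Polynomial.X_dvd_iff]
    have h0 := PowerSeries.X_pow_dvd_iff.1 hP 0 (by lia)
    rw [map_sub, Polynomial.coeff_coe, sub_eq_zero,
      PowerSeries.coeff_zero_eq_constantCoeff_apply, hφ] at h0
    exact h0.symm
  have h2 := isBigO_pow_eval hX
  simp only [pow_one] at h2
  exact ((hfP.trans h1).add h2).congr_left fun z => by ring

/-- The weights `c` are `1` for the logarithm itself and half-line moments for its integral against
`ρ_ℓ`. -/
theorem log_partialSum (hf : HasExpansion N f φ) (c : ℕ → ℝ) :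
    HasExpansion N (fun z => ∑ k ∈ Finset.Icc 1 N, (-1) ^ (k + 1) / (k : ℝ) * c k * f z ^ k)
      (∑ k ∈ Finset.Icc 1 N, ((-1) ^ (k + 1) / (k : ℝ) * c k) • φ ^ k) :=
  sum _ fun k _ => (hf.pow k).const_mul _

theorem log_one_add (hf : HasExpansion N f φ) (hφ : PowerSeries.constantCoeff φ = 0) :
    HasExpansion N (fun z => Real.log (1 + f z)) (PowerSeries.logOf (1 + φ)) := by
  have hO := hf.isBigO_self hφ
  have htend := hf.tendsto
  rw [hφ] at htend
  have hrem : (fun z => Real.log (1 + f z)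
      - ∑ k ∈ Finset.Icc 1 N, (-1) ^ (k + 1) / (k : ℝ) * 1 * f z ^ k)
        =O[𝓝[>] 0] fun z : ℝ => z ^ (N + 1) := by
    refine IsBigO.trans ?_ (hO.pow (N + 1))
    -- The remainder bound is `|f|^(N+1) / (1 - |f|)`, and `|f| < 1/2` eventually.
    refine IsBigO.of_bound 2 ?_
    have hsmall : ∀ᶠ z in 𝓝[>] (0 : ℝ), |f z| < 1 / 2 := by
      have := htend.abs
      rw [abs_zero] at this
      exact this.eventually_lt_const (by norm_num)
    filter_upwards [hsmall] with z hz
    have h := Real.abs_log_sub_add_sum_range_le (x := -f z) (by rw [abs_neg]; linarith) N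
    have hsum : ∀ M : ℕ, ∑ i ∈ Finset.range M, (-f z) ^ (i + 1) / ((i : ℝ) + 1)
        = -∑ k ∈ Finset.Icc 1 M, (-1) ^ (k + 1) / (k : ℝ) * 1 * f z ^ k := by
      intro M
      induction M with
      | zero => simp
      | succ M ih =>
        rw [Finset.sum_range_succ, Finset.sum_Icc_succ_top (by lia), ih, neg_pow]
        push_cast
        ring
    rw [hsum, neg_add_eq_sub, sub_neg_eq_add, abs_neg] at h
    rw [Real.norm_eq_abs, Real.norm_eq_abs, abs_pow]
    refine h.trans ?_
    rw [div_le_iff₀ (by linarith)]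
    have : 0 ≤ |f z| ^ (N + 1) := by positivity
    nlinarith
  have h := (hf.log_partialSum fun _ => 1).add (of_isBigO hrem)
  rw [add_zero] at h
  refine (h.congr_left (Eventually.of_forall fun z => by ring)).congr_right fun n hn => ?_
  rw [coeff_logOf_one_add hφ hn, map_sum]
  simp

theorem isBigO_sub_sum (hf : HasExpansion N f φ) (hφ : PowerSeries.constantCoeff φ = 0) :
    (fun z => f z - ∑ n ∈ Finset.Icc 1 N, PowerSeries.coeff n φ * z ^ n)
      =O[𝓝[>] 0] fun z : ℝ => z ^ (N + 1) := by
  obtain ⟨P, hP, hfP⟩ := hf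
  have hd : Polynomial.X ^ (N + 1) ∣ P - PowerSeries.trunc (N + 1) φ := by
    apply X_pow_dvd_of_coe
    have := dvd_sub (X_pow_dvd_sub_trunc (N + 1) φ) hP
    simpa using this
  refine (hfP.add (isBigO_pow_eval hd)).congr_left fun z => ?_
  have ht : (PowerSeries.trunc (N + 1) φ).eval z
      = ∑ n ∈ Finset.Icc 1 N, PowerSeries.coeff n φ * z ^ n := by
    rw [Polynomial.eval, PowerSeries.eval₂_trunc_eq_sum_range, Finset.sum_range_succ',
      Finset.range_eq_Ico]
    simp only [RingHom.id_apply]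
    rw [Finset.sum_Ico_add' (fun k => PowerSeries.coeff k φ * z ^ k)]
    simp [hφ]
    rfl
  rw [Polynomial.eval_sub, ht]
  ring

end HasExpansion

/-- The remainder has derivative `(-t)^N / (1 + t)`, at most `y^N` in size on `[0, y]`. No smallness
of `y` is required, so the bound can be integrated over all `u`. -/
theorem abs_log_one_add_sub_sum_le (N : ℕ) {y : ℝ} (hy : 0 ≤ y) :
    |Real.log (1 + y) - ∑ k ∈ Finset.Icc 1 N, (-1) ^ (k + 1) / (k : ℝ) * y ^ k| ≤ y ^ (N + 1) := by
  set R : ℝ → ℝ := fun t => Real.log (1 + t) - ∑ k ∈ Finset.Icc 1 N, (-1) ^ (k + 1) / (k : ℝ) * t ^ k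
  have hderiv : ∀ t, 0 ≤ t → HasDerivAt R ((-t) ^ N / (1 + t)) t := by
    intro t ht
    have h1 : HasDerivAt (fun t : ℝ => Real.log (1 + t)) (1 / (1 + t)) t :=
      ((hasDerivAt_id t).const_add 1).log (by simp; positivity)
    have h2 : HasDerivAt (fun t : ℝ => ∑ k ∈ Finset.Icc 1 N, (-1) ^ (k + 1) / (k : ℝ) * t ^ k)
        (∑ k ∈ Finset.Icc 1 N, (-1) ^ (k + 1) / (k : ℝ) * (k * t ^ (k - 1))) t :=
      HasDerivAt.fun_sum fun k _ => (hasDerivAt_pow k t).const_mul _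
    refine (h1.sub h2).congr_deriv ?_
    have hsum : ∀ M : ℕ, (1 + t) * ∑ k ∈ Finset.Icc 1 M, (-1) ^ (k + 1) / (k : ℝ) * (k * t ^ (k - 1))
        = 1 - (-t) ^ M := by
      intro M
      induction M with
      | zero => simp
      | succ M ih =>
        rw [Finset.sum_Icc_succ_top (by lia), mul_add, ih]
        have : ((M + 1 : ℕ) : ℝ) ≠ 0 := by positivity
        rw [← mul_assoc ((-1) ^ (M + 1 + 1) / _), div_mul_cancel₀ _ this, Nat.add_sub_cancel,
          neg_pow t, neg_pow t]
        ring
    have ht1 : 1 + t ≠ 0 := by positivity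
    rw [eq_div_iff ht1, sub_mul, mul_comm _ (1 + t), mul_comm _ (1 + t), hsum]
    field_simp
    ring
  have hR0 : R 0 = 0 := by
    simp only [R, add_zero, Real.log_one, zero_sub, neg_eq_zero]
    refine Finset.sum_eq_zero fun k hk => ?_
    rw [zero_pow (by have := (Finset.mem_Icc.1 hk).1; lia), mul_zero]
  have h := norm_image_sub_le_of_norm_deriv_le_segment' (f := R) (a := 0) (b := y) (C := y ^ N)
    (fun t ht => (hderiv t ht.1).hasDerivWithinAt) (fun t ht => ?_) y (Set.right_mem_Icc.2 hy)
  · rw [hR0, sub_zero, sub_zero, Real.norm_eq_abs] at h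
    rw [pow_succ]
    exact h
  · have ht0 : 0 ≤ t := ht.1
    rw [Real.norm_eq_abs, abs_div, abs_pow, abs_neg, abs_of_nonneg ht0,
      abs_of_pos (by linarith : 0 < 1 + t)]
    refine (div_le_self (by positivity) (by linarith)).trans ?_
    have := ht.2.le
    gcongr

end

end Norlund

/-! ### Expansion of the closed form. -/

namespace Norlund

noncomputable section

open MeasureTheory Filter

/-- `q(z) = 1 + (ℓ/2 - 2) z + z²` as a polynomial. -/
def qPoly (ℓ : ℕ) : Polynomial ℝ :=
  1 + Polynomial.C ((ℓ : ℝ) / 2 - 2) * Polynomial.X + Polynomial.X ^ 2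

theorem coe_qPoly (ℓ : ℕ) : (qPoly ℓ : ℝ⟦X⟧) = qSeries ℓ := by simp [qPoly, qSeries]

theorem eval_qPoly (ℓ : ℕ) (z : ℝ) :
    (qPoly ℓ).eval z = 1 + ((ℓ : ℝ) / 2 - 2) * z + z ^ 2 := by simp [qPoly]

theorem eval_qPoly_pos {ℓ : ℕ} (hℓ : 1 ≤ ℓ) {z : ℝ} (hz : 0 < z) : 0 < (qPoly ℓ).eval z := by
  rw [eval_qPoly]
  have : (1 : ℝ) ≤ ℓ := by exact_mod_cast hℓ
  -- `q = (z - 1)² + ℓz/2`.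
  nlinarith [sq_nonneg (z - 1)]

theorem xArg_sub_eq (ℓ : ℕ) {z : ℝ} (hz : 0 < z) :
    xArg ℓ z - (ℓ : ℝ) / 2 = (qPoly ℓ).eval z / z := by
  rw [eval_qPoly, xArg]
  field_simp
  ring

theorem xArg_ne {ℓ : ℕ} (hℓ : 1 ≤ ℓ) {z : ℝ} (hz : 0 < z) : xArg ℓ z ≠ (ℓ : ℝ) / 2 := by
  rw [← sub_ne_zero, xArg_sub_eq ℓ hz]
  exact (div_pos (eval_qPoly_pos hℓ hz) hz).ne'

theorem bArg_nonneg (ℓ : ℕ) (z : ℝ) : 0 ≤ bArg ℓ z := by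
  rw [bArg]
  positivity

theorem bArg_eq (ℓ : ℕ) {z : ℝ} (hz : 0 < z) :
    bArg ℓ z = z ^ 2 * ((qPoly ℓ).eval z ^ 2)⁻¹ := by
  rw [bArg, xArg_sub_eq ℓ hz, div_pow, inv_div, div_eq_mul_inv]

theorem hasExpansion_bArg (ℓ N : ℕ) : HasExpansion N (bArg ℓ) (bSeries ℓ) := by
  have hX : HasExpansion N (fun z => z ^ 2) (PowerSeries.X ^ 2) := by
    have h := HasExpansion.polynomial N (Polynomial.X ^ 2)
    rw [Polynomial.coe_pow, Polynomial.coe_X] at h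
    exact h.congr_left (Eventually.of_forall fun z => by simp)
  have hq := HasExpansion.polynomial N (qPoly ℓ)
  rw [coe_qPoly] at hq
  refine (hX.mul ((hq.pow 2).inv (by simp [constantCoeff_qSeries]))).congr_left ?_
  filter_upwards [self_mem_nhdsWithin] with z hz
  exact (bArg_eq ℓ hz).symm

theorem hasExpansion_log_qPoly (ℓ N : ℕ) :
    HasExpansion N (fun z => Real.log ((qPoly ℓ).eval z)) (PowerSeries.logOf (qSeries ℓ)) := by
  have h := HasExpansion.polynomial N (qPoly ℓ - 1)
  have hc : ((qPoly ℓ - 1 : Polynomial ℝ) : ℝ⟦X⟧) = qSeries ℓ - 1 := by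
    rw [Polynomial.coe_sub, coe_qPoly, Polynomial.coe_one]
  rw [hc] at h
  have := h.log_one_add (by simp [constantCoeff_qSeries])
  simpa using this

theorem integrableOn_log_mul_rho {ℓ : ℕ} (hℓ : 1 ≤ ℓ) {b : ℝ} (hb : 0 ≤ b) :
    IntegrableOn (fun u : ℝ => Real.log (1 + b * u ^ 2) * rho ℓ u) (Set.Ioi 0) := by
  have hint := ((integrable_pow_mul_rho hℓ 2).norm.const_mul b).integrableOn (s := Set.Ioi (0 : ℝ))
  refine hint.mono' ?_ (ae_of_all _ fun u => ?_)
  · refine AEStronglyMeasurable.mul ?_ (integrable_rho hℓ).aestronglyMeasurable.restrict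
    exact (by fun_prop : Measurable fun u : ℝ => Real.log (1 + b * u ^ 2)).aestronglyMeasurable
  · have hy : 0 ≤ b * u ^ 2 := by positivity
    -- Case `N = 0`: `|log(1 + y)| ≤ y`, so the second moment dominates.
    have h := abs_log_one_add_sub_sum_le 0 hy
    simp only [Finset.Icc_eq_empty_of_lt zero_lt_one, Finset.sum_empty, sub_zero, zero_add,
      pow_one] at h
    rw [norm_mul, norm_mul, Real.norm_eq_abs, Real.norm_eq_abs (u ^ 2), abs_of_nonneg (sq_nonneg u),
      ← mul_assoc]
    gcongr

/-- The moment `∫_0^∞ u^(2k) ρ_ℓ(u) du`. -/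
def halfMoment (ℓ k : ℕ) : ℝ := ∫ u in Set.Ioi (0 : ℝ), u ^ (2 * k) * rho ℓ u

theorem abs_integral_log_sub_sum_le {ℓ : ℕ} (hℓ : 1 ≤ ℓ) (N : ℕ) {b : ℝ} (hb : 0 ≤ b) :
    |(∫ u in Set.Ioi (0 : ℝ), Real.log (1 + b * u ^ 2) * rho ℓ u)
        - ∑ k ∈ Finset.Icc 1 N, (-1) ^ (k + 1) / (k : ℝ) * halfMoment ℓ k * b ^ k|
      ≤ (∫ u in Set.Ioi (0 : ℝ), ‖u ^ (2 * (N + 1)) * rho ℓ u‖) * b ^ (N + 1) := by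
  have hmom : ∀ k, IntegrableOn (fun u : ℝ => u ^ (2 * k) * rho ℓ u) (Set.Ioi 0) := fun k =>
    (integrable_pow_mul_rho hℓ (2 * k)).integrableOn
  have hsum : ∑ k ∈ Finset.Icc 1 N, (-1) ^ (k + 1) / (k : ℝ) * halfMoment ℓ k * b ^ k
      = ∫ u in Set.Ioi (0 : ℝ), ∑ k ∈ Finset.Icc 1 N,
          ((-1) ^ (k + 1) / (k : ℝ) * b ^ k) * (u ^ (2 * k) * rho ℓ u) := by
    rw [integral_finsetSum _ fun k _ => (hmom k).const_mul _]
    refine Finset.sum_congr rfl fun k _ => ?_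
    rw [integral_const_mul, halfMoment]
    ring
  rw [hsum, ← integral_sub (integrableOn_log_mul_rho hℓ hb)
    (integrable_finsetSum _ fun k _ => (hmom k).const_mul _), ← integral_mul_const,
    ← Real.norm_eq_abs]
  refine norm_integral_le_of_norm_le ((hmom (N + 1)).norm.mul_const _) (ae_of_all _ fun u => ?_)
  have h := abs_log_one_add_sub_sum_le N (by positivity : 0 ≤ b * u ^ 2)
  have heq : Real.log (1 + b * u ^ 2) * rho ℓ u
        - ∑ k ∈ Finset.Icc 1 N, ((-1) ^ (k + 1) / (k : ℝ) * b ^ k) * (u ^ (2 * k) * rho ℓ u)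
      = (Real.log (1 + b * u ^ 2)
        - ∑ k ∈ Finset.Icc 1 N, (-1) ^ (k + 1) / (k : ℝ) * (b * u ^ 2) ^ k) * rho ℓ u := by
    rw [sub_mul, Finset.sum_mul]
    congr 1
    refine Finset.sum_congr rfl fun k _ => ?_
    rw [mul_pow, ← pow_mul]
    ring
  rw [heq, norm_mul, norm_mul, Real.norm_eq_abs, Real.norm_eq_abs (u ^ _), pow_mul,
    abs_of_nonneg (by positivity : 0 ≤ (u ^ 2) ^ (N + 1))]
  calc _ ≤ (b * u ^ 2) ^ (N + 1) * ‖rho ℓ u‖ := by gcongr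
    _ = _ := by ring

theorem coeff_logMomentSeries {ℓ : ℕ} (hℓ : 1 ≤ ℓ) {n N : ℕ} (hn : n ≤ N) :
    PowerSeries.coeff n (logMomentSeries ℓ)
      = ∑ k ∈ Finset.Icc 1 N,
          (-1) ^ (k + 1) / (k : ℝ) * halfMoment ℓ k * PowerSeries.coeff n (bSeries ℓ ^ k) := by
  rw [logMomentSeries, PowerSeries.coeff_mk]
  simp_rw [coeff_logOf_one_add_bSeries ℓ hn, Finset.sum_mul, mul_assoc]
  rw [integral_finsetSum _ fun k _ =>
    ((integrable_pow_mul_rho hℓ (2 * k)).integrableOn.const_mul _).const_mul _]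
  refine Finset.sum_congr rfl fun k _ => ?_
  rw [integral_const_mul, integral_const_mul, halfMoment]
  ring

/-- The error in powers of `b` is `O(b^(N+1))`, and the crude bound `b = O(z)` is enough. -/
theorem hasExpansion_integral_log {ℓ : ℕ} (hℓ : 1 ≤ ℓ) (N : ℕ) :
    HasExpansion N
      (fun z => ∫ u in Set.Ioi (0 : ℝ), Real.log (1 + bArg ℓ z * u ^ 2) * rho ℓ u)
      (logMomentSeries ℓ) := by
  have hb := hasExpansion_bArg ℓ N
  have hbO := (hb.isBigO_self (constantCoeff_bSeries ℓ)).pow (N + 1)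
  have hrem : (fun z => (∫ u in Set.Ioi (0 : ℝ), Real.log (1 + bArg ℓ z * u ^ 2) * rho ℓ u)
      - ∑ k ∈ Finset.Icc 1 N, (-1) ^ (k + 1) / (k : ℝ) * halfMoment ℓ k * bArg ℓ z ^ k)
        =O[𝓝[>] 0] fun z : ℝ => z ^ (N + 1) := by
    refine IsBigO.trans (IsBigO.of_bound
      (∫ u in Set.Ioi (0 : ℝ), ‖u ^ (2 * (N + 1)) * rho ℓ u‖) (Eventually.of_forall fun z => ?_)) hbO
    rw [Real.norm_eq_abs, Real.norm_eq_abs (bArg ℓ z ^ (N + 1)),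
      abs_of_nonneg (pow_nonneg (bArg_nonneg ℓ z) _)]
    exact abs_integral_log_sub_sum_le hℓ N (bArg_nonneg ℓ z)
  have h := (hb.log_partialSum (halfMoment ℓ)).add (HasExpansion.of_isBigO hrem)
  rw [add_zero] at h
  refine (h.congr_left (Eventually.of_forall fun z => by ring)).congr_right fun n hn => ?_
  rw [coeff_logMomentSeries hℓ hn, map_sum]
  simp

theorem hasExpansion_closedForm {ℓ : ℕ} (hℓ : 1 ≤ ℓ) (N : ℕ) :
    HasExpansion N (closedForm ℓ) (genFun ℓ) := by
  have h := ((hasExpansion_log_qPoly ℓ N).const_mul (-(1 / 2))).add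
    ((hasExpansion_integral_log hℓ N).const_mul (-(1 / 2)))
  rw [genFun_eq hℓ, sub_eq_add_neg, ← neg_smul]
  refine h.congr_left ?_
  filter_upwards [self_mem_nhdsWithin] with z hz
  have hz : 0 < z := hz
  have hq := eval_qPoly_pos hℓ hz
  -- Since `x - ℓ/2 = q/z` with `q > 0`, the `log z` terms cancel and only `log q` remains.
  rw [closedForm, xArg_sub_eq ℓ hz, abs_of_pos (div_pos hq hz), Real.log_div hq.ne' hz.ne']
  ring

end

end Norlund

theorem mainTheorem4 (ℓ : ℕ) (hℓ : 1 ≤ ℓ) :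
    -- the right-hand side is meaningful for every `z > 0`
    (∀ z : ℝ, 0 < z →
      Norlund.xArg ℓ z ≠ (ℓ : ℝ) / 2 ∧
      MeasureTheory.IntegrableOn
        (fun u : ℝ => Real.log (1 + Norlund.bArg ℓ z * u ^ 2) * Norlund.rho ℓ u)
        (Set.Ioi 0)) ∧
    -- the generating function is its asymptotic expansion to all orders as `z → 0+`
    (∀ N : ℕ,
      (fun z : ℝ => Norlund.closedForm ℓ z
          - ∑ n ∈ Finset.Icc 1 N, Norlund.modNorlund ℓ n * z ^ n)
        =O[𝓝[>] 0] (fun z : ℝ => z ^ (N + 1))) ∧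
    -- the identity of formal power series
    (∀ n : ℕ, MeasureTheory.IntegrableOn
      (fun u : ℝ => PowerSeries.coeff n
        (PowerSeries.logOf (1 + Norlund.bSeries ℓ * PowerSeries.C (u ^ 2))) * Norlund.rho ℓ u)
      (Set.Ioi 0)) ∧
    Norlund.genFun ℓ =
      (-(1 / 2) : ℝ) • PowerSeries.logOf (Norlund.qSeries ℓ)
        - (1 / 2 : ℝ) • Norlund.logMomentSeries ℓ := by
  refine ⟨fun z hz => ⟨Norlund.xArg_ne hℓ hz,
    Norlund.integrableOn_log_mul_rho hℓ (Norlund.bArg_nonneg ℓ z)⟩, fun N => ?_,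
    fun n => (Norlund.integrable_coeff_logOf_mul_rho hℓ n).integrableOn, Norlund.genFun_eq hℓ⟩
  have h0 : PowerSeries.constantCoeff (Norlund.genFun ℓ) = 0 := by
    rw [← PowerSeries.coeff_zero_eq_constantCoeff_apply, Norlund.genFun, PowerSeries.coeff_mk,
      if_pos rfl]
  refine ((Norlund.hasExpansion_closedForm hℓ N).isBigO_sub_sum h0).congr_left fun z => ?_
  congr 1
  refine Finset.sum_congr rfl fun n hn => ?_
  rw [Norlund.genFun, PowerSeries.coeff_mk, if_neg (by have := (Finset.mem_Icc.1 hn).1; lia)]
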